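/- Let $(\mathcal H,\langle\cdot,\cdot\rangle)$ be a complex inner product space (inner product antilinear in the first argument), let $E\subseteq\mathcal H$ be a real linear subspace, and put $\sigma(f,g)=\operatorname{Im}\langle f,g\rangle$ and $\|f\|=\langle f,f\rangle^{1/2}$ for $f,g\in E$. For $h\ge 0$ let $\Delta(E,h\sigma)$ be the unital complex $*$-algebra with linear basis $\{W^h(f): f\in E\}$, product $W^h(f)W^h(g)=e^{-\frac i2 h\sigma(f,g)}W^h(f+g)$, involution $W^h(f)^*=W^h(-f)$ and unit $W^h(0)$. A state on $\Delta(E,h\sigma)$ is a linear functional $\omega$ with $\omega(A^*A)\ge 0$ for all $A$ and $\omega(W^h(0))=1$. Let $\mathcal W(E,h\sigma)$ be the $C^*$-algebra obtained by completing $\Delta(E,h\sigma)$ in the $C^*$-norm $\|A\|_h=\sup_\omega \omega(A^*A)^{1/2}$, the supremum being over all states $\omega$. Let $Q_h\colon\mathcal W(E,0)\to\mathcal W(E,h\sigma)$ be the unique continuous linear map with $$Q_h(W^0(f))=e^{-\frac h4\|f\|^2}\,W^h(f)\qquad (f\in E);$$ it is the continuous extension of a contraction $\Delta(E,0)\to\Delta(E,h\sigma)$.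 Then $Q_h$ is injective for every $h\ge 0$, and if $h>0$ and $E\ne\{0\}$, then $Q_h$ is not surjective. -/

import Mathlib

open scoped ComplexOrder

noncomputable section

namespace Weyl

/-! ### States of a unital complex star-algebra and the maximal C*-norm -/

/-- A state of a unital complex star-algebra `A`: a linear functional `ω` with
`ω (a* a) ≥ 0` for all `a` and `ω 1 = 1`. -/
structure AlgState (A : Type*) [Ring A] [StarRing A] [Algebra ℂ A] where
  toLin : A →ₗ[ℂ] ℂ
  nonneg : ∀ a : A, 0 ≤ toLin (star a * a)
  map_one : toLin 1 = 1

/-- `‖a‖ = sup {ω (a* a) | ω a state} ^ (1/2)`. -/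
def maxNorm {A : Type*} [Ring A] [StarRing A] [Algebra ℂ A] (a : A) : ℝ :=
  Real.sqrt (⨆ ω : AlgState A, (ω.toLin (star a * a)).re)

namespace AlgState

variable {A : Type*} [Ring A] [StarRing A] [Algebra ℂ A]

theorem re_nonneg (ω : AlgState A) (a : A) : 0 ≤ (ω.toLin (star a * a)).re :=
  (Complex.nonneg_iff.mp (ω.nonneg a)).1

theorem im_zero (ω : AlgState A) (a : A) : (ω.toLin (star a * a)).im = 0 :=
  (Complex.nonneg_iff.mp (ω.nonneg a)).2.symm

variable [StarModule ℂ A]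

theorem map_star (ω : AlgState A) (a : A) :
    ω.toLin (star a) = star (ω.toLin a) := by
  have h1 := ω.im_zero (a + 1)
  have h2 := ω.im_zero (Complex.I • a + 1)
  have h0 := ω.im_zero a
  simp only [star_add, star_one, add_mul, mul_add, mul_one, one_mul, star_smul, map_add,
    ω.map_one, smul_mul_assoc, mul_smul_comm, map_smul, smul_eq_mul, Complex.add_im,
    Complex.mul_im, Complex.I_re, Complex.I_im, Complex.star_def, Complex.conj_I,
    Complex.neg_re, Complex.neg_im, Complex.mul_re, Complex.one_im] at h1 h2
  apply Complex.ext
  · simp only [Complex.star_def, Complex.conj_re]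
    linarith
  · simp only [Complex.star_def, Complex.conj_im]
    linarith

/-- The positive semidefinite inner product `⟨a, b⟩ = ω (a* b)`. -/
@[reducible]
def core (ω : AlgState A) : PreInnerProductSpace.Core ℂ A where
  inner a b := ω.toLin (star a * b)
  conj_inner_symm a b := by
    have := ω.map_star (star b * a)
    simp only [star_mul, star_star] at this
    rw [this]; rfl
  re_inner_nonneg a := ω.re_nonneg a
  add_left a b c := by simp [add_mul]
  smul_left a b r := by simp

theorem sqrt_add_le (ω : AlgState A) (a b : A) :
    Real.sqrt (ω.toLin (star (a + b) * (a + b))).re ≤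
      Real.sqrt (ω.toLin (star a * a)).re + Real.sqrt (ω.toLin (star b * b)).re := by
  let G : SeminormedAddCommGroup A :=
    @InnerProductSpace.Core.toSeminormedAddCommGroup ℂ A _ _ _ ω.core
  exact @norm_add_le A G.toSeminormedAddGroup a b

theorem cauchy_schwarz (ω : AlgState A) (a b : A) :
    ‖ω.toLin (star a * b)‖ ^ 2 ≤ (ω.toLin (star a * a)).re * (ω.toLin (star b * b)).re := by
  have h := @InnerProductSpace.Core.inner_mul_inner_self_le ℂ A _ _ _ ω.core a b
  have h2 : ω.toLin (star b * a) = star (ω.toLin (star a * b)) := by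
    rw [← ω.map_star]; simp
  have h' : ‖ω.toLin (star a * b)‖ * ‖ω.toLin (star b * a)‖ ≤
    (ω.toLin (star a * a)).re * (ω.toLin (star b * b)).re := h
  rw [h2, norm_star] at h'
  rw [sq]; exact h'

theorem re_smul (ω : AlgState A) (c : ℂ) (a : A) :
    (ω.toLin (star (c • a) * (c • a))).re = ‖c‖ ^ 2 * (ω.toLin (star a * a)).re := by
  have h : star (c • a) * (c • a) = ((‖c‖ ^ 2 : ℝ) : ℂ) • (star a * a) := by
    rw [star_smul, smul_mul_smul_comm, Complex.star_def, Complex.conj_mul']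
    push_cast; rfl
  rw [h, map_smul, smul_eq_mul, Complex.re_ofReal_mul]

/-- The state `a ↦ ω (b* a b) / ω (b* b)`. -/
def conj (ω : AlgState A) (b : A) (hb : (ω.toLin (star b * b)).re ≠ 0) : AlgState A where
  toLin := (((ω.toLin (star b * b)).re⁻¹ : ℝ) : ℂ) •
    (ω.toLin ∘ₗ LinearMap.mulLeft ℂ (star b) ∘ₗ LinearMap.mulRight ℂ b)
  nonneg a := by
    have h := ω.nonneg (a * b)
    have e : star b * (star a * a * b) = star (a * b) * (a * b) := by
      simp [mul_assoc]
    simp only [LinearMap.smul_apply, LinearMap.comp_apply, LinearMap.mulLeft_apply,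
      LinearMap.mulRight_apply, smul_eq_mul, e]
    refine mul_nonneg ?_ h
    rw [Complex.zero_le_real]
    exact inv_nonneg.mpr (ω.re_nonneg b)
  map_one := by
    simp only [LinearMap.smul_apply, LinearMap.comp_apply, LinearMap.mulLeft_apply,
      LinearMap.mulRight_apply, smul_eq_mul, one_mul]
    apply Complex.ext
    · rw [Complex.re_ofReal_mul, inv_mul_cancel₀ hb, Complex.one_re]
    · rw [Complex.im_ofReal_mul, ω.im_zero, mul_zero, Complex.one_im]

end AlgState

section MaxNorm

variable {A : Type*} [Ring A] [StarRing A] [Algebra ℂ A]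

/-- The supremum defining the maximal norm is finite. -/
def StatesBounded (A : Type*) [Ring A] [StarRing A] [Algebra ℂ A] : Prop :=
  ∀ a : A, BddAbove (Set.range fun ω : AlgState A => (ω.toLin (star a * a)).re)

theorem maxNorm_nonneg (a : A) : 0 ≤ maxNorm a := Real.sqrt_nonneg _

theorem maxNorm_sq (a : A) :
    maxNorm a ^ 2 = ⨆ ω : AlgState A, (ω.toLin (star a * a)).re :=
  Real.sq_sqrt (Real.iSup_nonneg fun ω => ω.re_nonneg a)

theorem le_maxNorm_sq (hA : StatesBounded A) (ω : AlgState A) (a : A) :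
    (ω.toLin (star a * a)).re ≤ maxNorm a ^ 2 := by
  rw [maxNorm_sq]
  exact le_ciSup (hA a) ω

theorem maxNorm_le {a : A} {r : ℝ} (hr : 0 ≤ r)
    (h : ∀ ω : AlgState A, (ω.toLin (star a * a)).re ≤ r ^ 2) : maxNorm a ≤ r := by
  apply Real.sqrt_le_iff.mpr
  exact ⟨hr, Real.iSup_le h (sq_nonneg r)⟩

theorem maxNorm_neg (a : A) : maxNorm (-a) = maxNorm a := by simp [maxNorm]

theorem maxNorm_zero : maxNorm (0 : A) = 0 :=
  le_antisymm (maxNorm_le le_rfl fun ω => by simp) (maxNorm_nonneg _)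

variable [StarModule ℂ A]

theorem maxNorm_add_le (hA : StatesBounded A) (a b : A) :
    maxNorm (a + b) ≤ maxNorm a + maxNorm b := by
  refine maxNorm_le (add_nonneg (maxNorm_nonneg _) (maxNorm_nonneg _)) fun ω => ?_
  have h1 := ω.sqrt_add_le a b
  have h2 : Real.sqrt (ω.toLin (star a * a)).re ≤ maxNorm a :=
    Real.sqrt_le_iff.mpr ⟨maxNorm_nonneg _, le_maxNorm_sq hA ω a⟩
  have h3 : Real.sqrt (ω.toLin (star b * b)).re ≤ maxNorm b :=
    Real.sqrt_le_iff.mpr ⟨maxNorm_nonneg _, le_maxNorm_sq hA ω b⟩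
  exact (Real.sqrt_le_iff.mp ((h1.trans (add_le_add h2 h3)))).2

theorem maxNorm_mul_le (hA : StatesBounded A) (a b : A) :
    maxNorm (a * b) ≤ maxNorm a * maxNorm b := by
  refine maxNorm_le (mul_nonneg (maxNorm_nonneg _) (maxNorm_nonneg _)) fun ω => ?_
  rw [mul_pow]
  by_cases hb : (ω.toLin (star b * b)).re = 0
  · have h := ω.cauchy_schwarz b (star a * a * b)
    rw [hb, zero_mul] at h
    have h0 : ω.toLin (star b * (star a * a * b)) = 0 := by
      have := le_antisymm h (sq_nonneg _)
      simpa using this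
    have e : star (a * b) * (a * b) = star b * (star a * a * b) := by simp [mul_assoc]
    rw [e, h0, Complex.zero_re]
    positivity
  · have h1 := le_maxNorm_sq hA (ω.conj b hb) a
    have e : star b * (star a * a * b) = star (a * b) * (a * b) := by simp [mul_assoc]
    simp only [AlgState.conj, LinearMap.smul_apply, LinearMap.comp_apply, LinearMap.mulLeft_apply,
      LinearMap.mulRight_apply, smul_eq_mul, e, Complex.re_ofReal_mul] at h1
    have hpos : 0 < (ω.toLin (star b * b)).re := lt_of_le_of_ne (ω.re_nonneg b) (Ne.symm hb)
    rw [inv_mul_le_iff₀ hpos] at h1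
    refine h1.trans ?_
    rw [mul_comm]
    exact mul_le_mul_of_nonneg_left (le_maxNorm_sq hA ω b) (sq_nonneg _)

theorem maxNorm_smul_le (hA : StatesBounded A) (c : ℂ) (a : A) :
    maxNorm (c • a) ≤ ‖c‖ * maxNorm a := by
  refine maxNorm_le (mul_nonneg (norm_nonneg _) (maxNorm_nonneg _)) fun ω => ?_
  rw [ω.re_smul, mul_pow]
  exact mul_le_mul_of_nonneg_left (le_maxNorm_sq hA ω a) (sq_nonneg _)

theorem maxNorm_sq_le_star_mul_self (hA : StatesBounded A) (a : A) :
    maxNorm a * maxNorm a ≤ maxNorm (star a * a) := by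
  rw [← sq, maxNorm_sq]
  refine Real.iSup_le (fun ω => ?_) (maxNorm_nonneg _)
  have h := ω.cauchy_schwarz 1 (star a * a)
  simp only [star_one, one_mul, ω.map_one, Complex.one_re] at h
  have h2 := h.trans (le_maxNorm_sq hA ω (star a * a))
  exact (Complex.re_le_norm _).trans (abs_le_of_sq_le_sq' h2 (maxNorm_nonneg _)).2

end MaxNorm

/-! ### The Weyl star-algebra `Δ(E, hσ)`

`E` is a real subspace of the complex inner product space `H`, with the symplectic form
`σ = Im ⟨·, ·⟩`. -/

variable {H : Type*} [NormedAddCommGroup H] [InnerProductSpace ℂ H]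

/-- The form `σ(f, g) = Im ⟨f, g⟩` on `E`. -/
def symp (E : Submodule ℝ H) (f g : E) : ℝ := (inner ℂ (f : H) (g : H)).im

/-- `Δ(E, hσ)`: finite linear combinations of symbols `W(f)`, `f ∈ E`, with the product
`W(f) W(g) = exp (-(i/2) h σ(f, g)) W(f + g)` and the involution `W(f)* = W(-f)`. -/
def Alg (E : Submodule ℝ H) (_h : NNReal) : Type _ := E →₀ ℂ

namespace Alg

variable {E : Submodule ℝ H} {h : NNReal}

instance : AddCommGroup (Alg E h) := inferInstanceAs (AddCommGroup (E →₀ ℂ))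

instance : Module ℂ (Alg E h) := inferInstanceAs (Module ℂ (E →₀ ℂ))

/-- The coefficient of `W(f)`, as a linear functional. -/
def coeff (f : E) : Alg E h →ₗ[ℂ] ℂ := Finsupp.lapply (R := ℂ) (M := ℂ) f

/-- The finite set of `f` such that `W(f)` has a nonzero coefficient. -/
def supp (a : Alg E h) : Finset E := Finsupp.support (M := ℂ) a

theorem ext {a b : Alg E h} (hab : ∀ f, coeff f a = coeff f b) : a = b :=
  Finsupp.ext (f := (a : E →₀ ℂ)) hab

theorem mem_supp {a : Alg E h} {f : E} : f ∈ supp a ↔ coeff f a ≠ 0 :=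
  Finsupp.mem_support_iff (f := (a : E →₀ ℂ))

/-- The Weyl element `W(f)`. -/
def W (E : Submodule ℝ H) (h : NNReal) (f : E) : Alg E h := Finsupp.single f (1 : ℂ)

/-- The linear map on `Δ(E, hσ)` with prescribed values on the Weyl elements. -/
def lift {M : Type*} [AddCommMonoid M] [Module ℂ M] (u : E → M) : Alg E h →ₗ[ℂ] M :=
  Finsupp.linearCombination ℂ u

@[simp]
theorem lift_W {M : Type*} [AddCommMonoid M] [Module ℂ M] (u : E → M) (f : E) :
    lift u (W E h f) = u f := by
  change Finsupp.linearCombination ℂ u (Finsupp.single f (1 : ℂ)) = u f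
  rw [Finsupp.linearCombination_single, one_smul]

/-- The phase `exp (-(i/2) h σ(f, g))`. -/
def phase (E : Submodule ℝ H) (h : NNReal) (f g : E) : ℂ :=
  Complex.exp (-(Complex.I / 2) * ((h * symp E f g : ℝ) : ℂ))

/-- The product as a bilinear map. -/
def mulMap (E : Submodule ℝ H) (h : NNReal) : Alg E h →ₗ[ℂ] Alg E h →ₗ[ℂ] Alg E h :=
  lift fun f => lift fun g => phase E h f g • W E h (f + g)

instance : Mul (Alg E h) := ⟨fun a b => mulMap E h a b⟩

instance : One (Alg E h) := ⟨W E h 0⟩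

/-- The involution, `∑ z_f W(f) ↦ ∑ conj z_f W(-f)`. -/
instance : Star (Alg E h) :=
  ⟨fun a => Finsupp.sum (a : E →₀ ℂ) fun f z => (starRingEnd ℂ z) • W E h (-f)⟩

theorem mul_def (a b : Alg E h) : a * b = mulMap E h a b := rfl

theorem one_def : (1 : Alg E h) = W E h 0 := rfl

theorem W_mul_W (f g : E) : W E h f * W E h g = phase E h f g • W E h (f + g) := by
  simp [mul_def, mulMap]

theorem smul_W_eq (z : ℂ) (f : E) : z • W E h f = (Finsupp.single f z : E →₀ ℂ) := by
  change z • (Finsupp.single f (1 : ℂ) : E →₀ ℂ) = _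
  simp

@[elab_as_elim]
theorem induction {p : Alg E h → Prop} (a : Alg E h) (zero : p 0)
    (add : ∀ a b, p a → p b → p (a + b)) (smul_W : ∀ (z : ℂ) f, p (z • W E h f)) : p a :=
  Finsupp.induction_linear (motive := p) a zero add fun f z => by
    rw [← smul_W_eq (h := h)]; exact smul_W z f

theorem eq_sum (a : Alg E h) :
    a = ∑ f ∈ supp a, coeff f a • W E h f := by
  conv_lhs => rw [← Finsupp.sum_single (a : E →₀ ℂ)]
  exact Finset.sum_congr rfl fun f _ => (smul_W_eq _ _).symm

theorem symp_self (f : E) : symp E f f = 0 := by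
  simpa [symp] using inner_self_im (𝕜 := ℂ) (f : H)

theorem symp_swap (f g : E) : symp E g f = -symp E f g := by
  simp only [symp]
  rw [← inner_conj_symm, Complex.conj_im]

theorem symp_add_left (f g k : E) : symp E (f + g) k = symp E f k + symp E g k := by
  simp [symp]

theorem symp_add_right (f g k : E) : symp E f (g + k) = symp E f g + symp E f k := by
  simp [symp]

theorem symp_neg_left (f g : E) : symp E (-f) g = -symp E f g := by
  simp [symp, inner_neg_left]

theorem symp_neg_right (f g : E) : symp E f (-g) = -symp E f g := by
  simp [symp, inner_neg_right]

theorem symp_zero_left (f : E) : symp E 0 f = 0 := by simp [symp]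

theorem symp_zero_right (f : E) : symp E f 0 = 0 := by simp [symp]

theorem star_phase (f g : E) : star (phase E h f g) = phase E h g f := by
  simp only [phase, Complex.star_def, ← Complex.exp_conj, symp_swap f g]
  congr 1
  have h2 : (starRingEnd ℂ) (2 : ℂ) = 2 := Complex.conj_ofNat 2
  simp [map_div₀, neg_div, h2]

protected theorem mul_assoc (a b c : Alg E h) : a * b * c = a * (b * c) := by
  simp only [mul_def]
  induction a using induction with
  | zero => simp
  | add a a' ha ha' => simp [ha, ha']
  | smul_W z f =>
    induction b using induction with
    | zero => simp
    | add b b' hb hb' =>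
      simp only [map_add, LinearMap.add_apply, hb, hb']
    | smul_W y g =>
      induction c using induction with
      | zero => simp
      | add c c' hc hc' => simp only [map_add, hc, hc']
      | smul_W x k =>
        simp only [map_smul, LinearMap.smul_apply, mulMap, lift_W, smul_smul, add_assoc]
        congr 1
        have : phase E h f g * phase E h (f + g) k =
            phase E h g k * phase E h f (g + k) := by
          simp only [phase, ← Complex.exp_add, symp_add_left, symp_add_right]
          congr 1
          push_cast
          ring
        linear_combination z * y * x * this

theorem phase_zero_left (f : E) : phase E h 0 f = 1 := by simp [phase, symp_zero_left]

theorem phase_zero_right (f : E) : phase E h f 0 = 1 := by simp [phase, symp_zero_right]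

instance : Ring (Alg E h) where
  mul_assoc := Alg.mul_assoc
  left_distrib a b c := by simp [mul_def]
  right_distrib a b c := by simp [mul_def]
  zero_mul a := by simp [mul_def]
  mul_zero a := by simp [mul_def]
  one_mul a := by
    simp only [mul_def, one_def]
    induction a using induction with
    | zero => simp
    | add a b ha hb => simp [ha, hb]
    | smul_W z f => simp [mulMap, phase_zero_left]
  mul_one a := by
    simp only [mul_def, one_def]
    induction a using induction with
    | zero => simp
    | add a b ha hb => simp [ha, hb]
    | smul_W z f => simp [mulMap, phase_zero_right]
  neg_add_cancel := neg_add_cancel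
  zsmul := (· • ·)
  zsmul_zero' := SubNegMonoid.zsmul_zero'
  zsmul_succ' := SubNegMonoid.zsmul_succ'
  zsmul_neg' := SubNegMonoid.zsmul_neg'
  sub_eq_add_neg := sub_eq_add_neg
  add_comm := add_comm

instance : Algebra ℂ (Alg E h) :=
  Algebra.ofModule (fun r a b => by simp [mul_def]) (fun r a b => by simp [mul_def])

theorem star_add' (a b : Alg E h) : star (a + b) = star a + star b :=
  Finsupp.sum_add_index' (fun f => by simp) (fun f z y => by rw [map_add, add_smul])

theorem star_zero' : star (0 : Alg E h) = 0 := Finsupp.sum_zero_index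

theorem star_smul_W (z : ℂ) (f : E) :
    star (z • W E h f) = (starRingEnd ℂ z) • W E h (-f) := by
  rw [smul_W_eq]
  exact Finsupp.sum_single_index (by simp)

theorem star_W (f : E) : star (W E h f) = W E h (-f) := by
  simpa using star_smul_W (h := h) 1 f

instance : StarRing (Alg E h) where
  star_add := star_add'
  star_involutive a := by
    induction a using induction with
    | zero => simp [star_zero']
    | add a b ha hb => rw [star_add', star_add', ha, hb]
    | smul_W z f => simp [star_smul_W]
  star_mul a b := by
    induction a using induction with
    | zero => simp [star_zero']
    | add a a' ha ha' => rw [add_mul, star_add', ha, ha', star_add', mul_add]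
    | smul_W z f =>
      induction b using induction with
      | zero => simp [star_zero']
      | add b b' hb hb' => rw [mul_add, star_add', hb, hb', star_add', add_mul]
      | smul_W y g =>
        rw [smul_mul_smul_comm, W_mul_W, smul_smul, star_smul_W, star_smul_W, star_smul_W,
          smul_mul_smul_comm, W_mul_W, smul_smul]
        have e : -g + -f = -(f + g) := by abel
        have e2 : phase E h (-g) (-f) = starRingEnd ℂ (phase E h f g) := by
          have := star_phase (h := h) f g
          rw [Complex.star_def] at this
          rw [this]
          simp [phase, symp_neg_left, symp_neg_right]
        rw [e, e2]
        congr 1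
        simp only [map_mul]
        ring

instance : StarModule ℂ (Alg E h) where
  star_smul z a := by
    induction a using induction with
    | zero => simp
    | add a b ha hb => rw [smul_add, star_add', ha, hb, star_add', smul_add]
    | smul_W y f => simp [smul_smul, star_smul_W]

theorem star_W_mul_W (f g : E) :
    star (W E h f) * W E h g = star (phase E h f g) • W E h (g - f) := by
  rw [star_W, W_mul_W, star_phase, neg_add_eq_sub]
  congr 1
  simp only [phase, symp_neg_left, symp_swap f g]

theorem star_W_mul_self (f : E) : star (W E h f) * W E h f = 1 := by
  rw [star_W_mul_W, sub_self, one_def]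
  simp [phase, symp_self]

theorem star_sum_mul_sum (s : Finset E) (v w : E → ℂ) :
    star (∑ f ∈ s, v f • W E h f) * (∑ f ∈ s, w f • W E h f) =
      ∑ f ∈ s, ∑ g ∈ s, (star (v f) * w g) • (star (W E h f) * W E h g) := by
  rw [star_sum, Finset.sum_mul]
  refine Finset.sum_congr rfl fun f _ => ?_
  rw [Finset.mul_sum]
  refine Finset.sum_congr rfl fun g _ => ?_
  rw [star_smul, smul_mul_smul_comm]

theorem statesBounded : StatesBounded (Alg E h) := by
  have key : ∀ a : Alg E h, ∃ C : ℝ, ∀ ω : AlgState (Alg E h),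
      Real.sqrt (ω.toLin (star a * a)).re ≤ C := by
    intro a
    induction a using induction with
    | zero => exact ⟨0, fun ω => by simp⟩
    | add a b ha hb =>
      obtain ⟨C, hC⟩ := ha
      obtain ⟨D, hD⟩ := hb
      exact ⟨C + D, fun ω => (ω.sqrt_add_le a b).trans (add_le_add (hC ω) (hD ω))⟩
    | smul_W z f =>
      refine ⟨‖z‖, fun ω => ?_⟩
      rw [ω.re_smul, star_W_mul_self, ω.map_one, Complex.one_re, mul_one,
        Real.sqrt_sq (norm_nonneg z)]
  intro a
  obtain ⟨C, hC⟩ := key a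
  refine ⟨C ^ 2, ?_⟩
  rintro _ ⟨ω, rfl⟩
  exact (Real.sqrt_le_iff.mp (hC ω)).2

theorem coeff_W [DecidableEq E] (f g : E) :
    coeff f (W E h g) = if f = g then 1 else 0 := by
  split_ifs with hfg
  · subst hfg
    exact Finsupp.single_eq_same
  · exact Finsupp.single_eq_of_ne hfg

theorem coeff_zero_star_mul_self (a : Alg E h) :
    coeff 0 (star a * a) = ∑ f ∈ supp a, star (coeff f a) * coeff f a := by
  classical
  have hW : ∀ f g : E,
      coeff (0 : E) (star (W E h f) * W E h g) = if f = g then 1 else 0 := by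
    intro f g
    split_ifs with hfg
    · subst hfg
      rw [star_W_mul_self, one_def, coeff_W, if_pos rfl]
    · rw [star_W_mul_W, map_smul, coeff_W, if_neg (sub_ne_zero.mpr (Ne.symm hfg)).symm, smul_zero]
  conv_lhs => rw [eq_sum a, star_sum_mul_sum, map_sum]
  refine Finset.sum_congr rfl fun f hf => ?_
  rw [map_sum]
  simp only [map_smul, hW, smul_eq_mul, mul_ite, mul_one, mul_zero]
  rw [Finset.sum_ite_eq, if_pos hf]

/-- The canonical central state, `W(f) ↦ 1` if `f = 0` and `W(f) ↦ 0` otherwise. -/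
def centralState (E : Submodule ℝ H) (h : NNReal) : AlgState (Alg E h) where
  toLin := coeff 0
  nonneg a := by
    rw [coeff_zero_star_mul_self]
    exact Finset.sum_nonneg fun f _ => star_mul_self_nonneg _
  map_one := by
    classical
    rw [one_def, coeff_W, if_pos rfl]

theorem eq_zero_of_maxNorm (a : Alg E h) (ha : maxNorm a = 0) : a = 0 := by
  have h1 := le_maxNorm_sq statesBounded (centralState E h) a
  have h3 : coeff 0 (star a * a) = 0 := by
    have hr := (centralState E h).re_nonneg a
    rw [ha] at h1
    apply Complex.ext
    · change ((centralState E h).toLin (star a * a)).re = 0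
      linarith
    · exact (centralState E h).im_zero a
  rw [coeff_zero_star_mul_self] at h3
  have h6 := (Finset.sum_eq_zero_iff_of_nonneg
    (fun f _ => star_mul_self_nonneg (coeff f a))).mp h3
  refine ext fun f => ?_
  rw [map_zero]
  by_contra hf
  have := h6 f (mem_supp.mpr hf)
  exact hf (by simpa using this)

/-- `Δ(E, hσ)` with the maximal C*-norm. -/
instance : NormedRing (Alg E h) where
  norm := maxNorm
  dist a b := maxNorm (-a + b)
  dist_self a := by simp [maxNorm_zero]
  dist_comm a b := by rw [← maxNorm_neg]; congr 1; abel
  dist_triangle a b c := by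
    have e : -a + c = (-a + b) + (-b + c) := by abel
    rw [e]; exact maxNorm_add_le statesBounded _ _
  eq_of_dist_eq_zero hab := by
    have := eq_zero_of_maxNorm _ hab
    exact (neg_add_eq_zero.mp this)
  dist_eq a b := rfl
  norm_mul_le a b := maxNorm_mul_le statesBounded a b

instance : NormedAlgebra ℂ (Alg E h) where
  norm_smul_le c a := maxNorm_smul_le statesBounded c a

theorem norm_def (a : Alg E h) : ‖a‖ = maxNorm a := rfl

instance : CStarRing (Alg E h) where
  norm_mul_self_le a := maxNorm_sq_le_star_mul_self statesBounded a

end Alg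

/-! ### The Weyl C*-algebra `W(E, hσ)` -/

/-- `W(E, hσ)`: the completion of `Δ(E, hσ)` in the maximal C*-norm. -/
abbrev CStar (E : Submodule ℝ H) (h : NNReal) : Type _ :=
  UniformSpace.Completion (Alg E h)

section CStar

open UniformSpace

variable {E : Submodule ℝ H} {h : NNReal}

instance : Star (CStar E h) := ⟨Completion.map star⟩

theorem coe_star (a : Alg E h) : ((star a : Alg E h) : CStar E h) = star (a : CStar E h) :=
  (Completion.map_coe (starₗᵢ ℂ (E := Alg E h)).isometry.uniformContinuous a).symm

instance : ContinuousStar (CStar E h) := ⟨Completion.continuous_map⟩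

instance : StarRing (CStar E h) where
  star_involutive a := by
    induction a using Completion.induction_on with
    | hp => exact isClosed_eq (by fun_prop) (by fun_prop)
    | ih a => rw [← coe_star, ← coe_star, star_star]
  star_mul a b := by
    induction a, b using Completion.induction_on₂ with
    | hp => exact isClosed_eq (by fun_prop) (by fun_prop)
    | ih a b =>
      rw [← Completion.coe_mul, ← coe_star, ← coe_star, ← coe_star, ← Completion.coe_mul, star_mul]
  star_add a b := by
    induction a, b using Completion.induction_on₂ with
    | hp => exact isClosed_eq (by fun_prop) (by fun_prop)
    | ih a b =>
      rw [← Completion.coe_add, ← coe_star, ← coe_star, ← coe_star, ← Completion.coe_add, star_add]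

instance : NormedAlgebra ℂ (CStar E h) where
  norm_smul_le := norm_smul_le

instance : StarModule ℂ (CStar E h) where
  star_smul z a := by
    induction a using Completion.induction_on with
    | hp =>
      exact isClosed_eq (continuous_star.comp (continuous_const_smul z))
        (continuous_star.const_smul (star z))
    | ih a =>
      rw [← Completion.coe_smul, ← coe_star, ← coe_star, ← Completion.coe_smul, star_smul]

instance : CStarRing (CStar E h) where
  norm_mul_self_le a := by
    induction a using Completion.induction_on with
    | hp => exact isClosed_le (by fun_prop) (by fun_prop)
    | ih a =>
      rw [← coe_star, ← Completion.coe_mul, Completion.norm_coe, Completion.norm_coe]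
      exact CStarRing.norm_mul_self_le a

/-- `W(E, hσ)` is a unital C*-algebra. -/
instance : CStarAlgebra (CStar E h) where

/-- The Weyl element `W^h(f)` of `W(E, hσ)`. -/
def weyl (E : Submodule ℝ H) (h : NNReal) (f : E) : CStar E h := (Alg.W E h f : Alg E h)

end CStar

/-! ### The quantization map -/

/-- The algebraic quantization map `Δ(E, 0) → Δ(E, hσ)`,
`W⁰(f) ↦ exp (-(h/4) ‖f‖²) W^h(f)`. -/
def quantAlg (E : Submodule ℝ H) (h : NNReal) : Alg E 0 →ₗ[ℂ] Alg E h :=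
  Alg.lift fun f => (Real.exp (-(h / 4 : ℝ) * ‖f‖ ^ 2) : ℂ) • Alg.W E h f

namespace Alg

variable {E : Submodule ℝ H} {h : NNReal}

theorem quantAlg_W (f : E) :
    quantAlg E h (W E 0 f) = (Real.exp (-(h / 4 : ℝ) * ‖f‖ ^ 2) : ℂ) • W E h f := by
  simp [quantAlg]

/-- The damped coefficients `z_f exp (-(h/4) ‖f‖²)`. -/
def damp (h : NNReal) (v : E → ℂ) (f : E) : ℂ :=
  v f * (Real.exp (-(h / 4 : ℝ) * ‖f‖ ^ 2) : ℂ)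

theorem quantAlg_sum (s : Finset E) (v : E → ℂ) :
    quantAlg E h (∑ f ∈ s, v f • W E 0 f) = ∑ f ∈ s, damp h v f • W E h f := by
  simp [quantAlg_W, damp, smul_smul]

theorem quantAlg_star_W_mul_W (f g : E) :
    quantAlg E h (star (W E 0 f) * W E 0 g) =
      ((Real.exp (-(h / 4 : ℝ) * ‖f‖ ^ 2) : ℂ) * (Real.exp (-(h / 4 : ℝ) * ‖g‖ ^ 2) : ℂ) *
        Complex.exp ((h / 2 : ℝ) * inner ℂ (g : H) (f : H))) • (star (W E h f) * W E h g) := by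
  have h0 : phase E 0 f g = 1 := by simp [phase]
  rw [star_W_mul_W, star_W_mul_W, map_smul, quantAlg_W, smul_smul, smul_smul, h0, star_one,
    one_mul]
  congr 1
  rw [star_phase, phase, Complex.ofReal_exp, Complex.ofReal_exp, Complex.ofReal_exp,
    ← Complex.exp_add, ← Complex.exp_add, ← Complex.exp_add]
  congr 1
  have hn : ‖g - f‖ ^ 2 = ‖g‖ ^ 2 - 2 * (inner ℂ (g : H) (f : H)).re + ‖f‖ ^ 2 := by
    simpa using norm_sub_sq (𝕜 := ℂ) (g : H) (f : H)
  rw [hn, symp]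
  apply Complex.ext
  · simp
    ring
  · simp
    ring

/-- The kernel `ω (W(f)* W(g)) ⟨g, f⟩ⁿ` is positive semidefinite. -/
theorem kernel_nonneg (ω : AlgState (Alg E h)) (s : Finset E) (n : ℕ) (v : E → ℂ) :
    0 ≤ ∑ f ∈ s, ∑ g ∈ s, star (v f) * v g *
      (ω.toLin (star (W E h f) * W E h g) * inner ℂ (g : H) (f : H) ^ n) := by
  classical
  let P : Matrix s s ℂ := Matrix.of fun f g => ω.toLin (star (W E h f.1) * W E h g.1)
  let G : Matrix s s ℂ := (Matrix.gram ℂ fun f : s => (f.1 : H)).transpose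
  have hP : P.PosSemidef := by
    refine Matrix.PosSemidef.of_dotProduct_mulVec_nonneg ?_ fun x => ?_
    · ext f g
      simp only [P, Matrix.conjTranspose_apply, Matrix.of_apply, ← ω.map_star]
      simp
    · have hx := ω.nonneg (∑ f : s, x f • W E h f.1)
      convert hx using 1
      rw [star_sum, Finset.sum_mul, map_sum]
      refine Finset.sum_congr rfl fun f _ => ?_
      rw [Finset.mul_sum, map_sum, Matrix.mulVec, dotProduct, Finset.mul_sum]
      refine Finset.sum_congr rfl fun g _ => ?_
      rw [star_smul, smul_mul_smul_comm, map_smul, smul_eq_mul]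
      simp only [P, Matrix.of_apply, Pi.star_apply]
      ring
  have hG : G.PosSemidef := (Matrix.posSemidef_gram (𝕜 := ℂ) _).transpose
  have hK : ∀ n : ℕ, (Matrix.of fun f g : s => P f g * G f g ^ n).PosSemidef := by
    intro n
    induction n with
    | zero =>
      have e : (Matrix.of fun f g : s => P f g * G f g ^ 0) = P := by ext f g; simp
      rw [e]; exact hP
    | succ n ih =>
      have e : (Matrix.of fun f g : s => P f g * G f g ^ (n + 1)) =
          Matrix.hadamard (Matrix.of fun f g : s => P f g * G f g ^ n) G := by
        ext f g
        simp only [Matrix.of_apply, Matrix.hadamard_apply]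
        ring
      rw [e]
      exact Matrix.PosSemidef.hadamard ih hG
  have hv := (hK n).dotProduct_mulVec_nonneg fun f : s => v f.1
  convert hv using 1
  rw [dotProduct, ← Finset.sum_coe_sort s]
  refine Finset.sum_congr rfl fun f _ => ?_
  rw [Matrix.mulVec, dotProduct, Finset.mul_sum, ← Finset.sum_coe_sort s]
  refine Finset.sum_congr rfl fun g _ => ?_
  simp only [Matrix.of_apply, Pi.star_apply, P, G, Matrix.transpose_apply, Matrix.gram_apply]
  ring

theorem quantAlg_star_mul_self (ω : AlgState (Alg E h)) (a : Alg E 0) :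
    0 ≤ ω.toLin (star (quantAlg E h a) * quantAlg E h a) ∧
    ω.toLin (star (quantAlg E h a) * quantAlg E h a) ≤ ω.toLin (quantAlg E h (star a * a)) := by
  refine ⟨ω.nonneg _, ?_⟩
  set s := supp a with hs
  set v : E → ℂ := damp h fun f => coeff f a with hv
  have ea : a = ∑ f ∈ s, coeff f a • W E 0 f := eq_sum a
  let T : ℕ → ℂ := fun n => ∑ f ∈ s, ∑ g ∈ s, star (v f) * v g *
    (ω.toLin (star (W E h f) * W E h g) * (((h / 2 : ℝ) * inner ℂ (g : H) (f : H)) ^ n / n.factorial))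
  have hT : ∀ n, 0 ≤ T n := by
    intro n
    have hc : (0 : ℂ) ≤ (((h / 2 : ℝ) ^ n / n.factorial : ℝ) : ℂ) := by
      rw [Complex.zero_le_real]; positivity
    have := mul_nonneg hc (kernel_nonneg ω s n v)
    convert this using 1
    simp only [T, Finset.mul_sum]
    refine Finset.sum_congr rfl fun f _ => Finset.sum_congr rfl fun g _ => ?_
    rw [mul_pow]
    push_cast
    ring
  have e0 : ω.toLin (star (quantAlg E h a) * quantAlg E h a) = T 0 := by
    conv_lhs => rw [ea, quantAlg_sum, star_sum_mul_sum, map_sum]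
    refine Finset.sum_congr rfl fun f _ => ?_
    rw [map_sum]
    refine Finset.sum_congr rfl fun g _ => ?_
    rw [map_smul, smul_eq_mul]
    simp [hv]
  have e1 : HasSum T (ω.toLin (quantAlg E h (star a * a))) := by
    have : ω.toLin (quantAlg E h (star a * a)) = ∑ f ∈ s, ∑ g ∈ s, star (v f) * v g *
        (ω.toLin (star (W E h f) * W E h g) *
          Complex.exp ((h / 2 : ℝ) * inner ℂ (g : H) (f : H))) := by
      conv_lhs => rw [ea, star_sum_mul_sum, map_sum, map_sum]
      refine Finset.sum_congr rfl fun f _ => ?_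
      rw [map_sum, map_sum]
      refine Finset.sum_congr rfl fun g _ => ?_
      rw [map_smul, quantAlg_star_W_mul_W, map_smul, map_smul, smul_eq_mul, smul_eq_mul]
      simp only [hv, damp, star_mul', Complex.star_def, Complex.conj_ofReal]
      ring
    rw [this]
    refine hasSum_sum fun f _ => hasSum_sum fun g _ => ?_
    refine HasSum.mul_left _ (HasSum.mul_left _ ?_)
    rw [Complex.exp_eq_exp_ℂ]
    exact NormedSpace.expSeries_div_hasSum_exp _
  rw [e0]
  exact le_hasSum e1 0 fun n _ => hT n

/-- The pull-back of a state under the quantization map. -/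
def pullback (ω : AlgState (Alg E h)) : AlgState (Alg E 0) where
  toLin := ω.toLin ∘ₗ quantAlg E h
  nonneg a := (quantAlg_star_mul_self ω a).1.trans (quantAlg_star_mul_self ω a).2
  map_one := by
    rw [LinearMap.comp_apply, one_def, quantAlg_W]
    simp [← one_def, ω.map_one]

theorem norm_quantAlg_le (a : Alg E 0) : ‖quantAlg E h a‖ ≤ 1 * ‖a‖ := by
  rw [one_mul, norm_def, norm_def]
  refine maxNorm_le (maxNorm_nonneg _) fun ω => ?_
  exact (Complex.le_def.mp (quantAlg_star_mul_self ω a).2).1.trans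
    (le_maxNorm_sq statesBounded (pullback ω) a)

end Alg

/-- The quantization map `Q_h : W(E, 0) → W(E, hσ)`: the continuous linear extension of the
algebraic quantization map to the completions. -/
def quant (E : Submodule ℝ H) (h : NNReal) : CStar E 0 →L[ℂ] CStar E h :=
  ((quantAlg E h).mkContinuous 1 Alg.norm_quantAlg_le).completion

theorem quant_weyl (E : Submodule ℝ H) (h : NNReal) (f : E) :
    quant E h (weyl E 0 f) = (Real.exp (-(h / 4 : ℝ) * ‖f‖ ^ 2) : ℂ) • weyl E h f := by
  rw [quant, weyl, ContinuousLinearMap.completion_apply_coe, LinearMap.mkContinuous_apply,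
    Alg.quantAlg_W, UniformSpace.Completion.coe_smul, weyl]

end Weyl

end

/-! On Weyl elements `Q_h` multiplies the coefficient at `f` by a nonzero Gaussian factor, so it is
invertible at the algebraic level, but the inverse factors are unbounded and need not extend to the
completions. The remedy is Fejér summation over `E` viewed as a discrete abelian group.

For a finite nonempty `F ⊆ E` the multiplier `f ↦ |F ∩ (F - f)| / |F|` is positive definite, has
value 1 at 0 and vanishes off `F - F`. It defines a contraction of the Weyl algebra for every `h`
(`Alg.fejer_schwarz`). Abelian groups have almost invariant finite sets
(`exists_almost_invariant_finset`), so suitable Fejér means of any element of the completion come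
arbitrarily close to it (`exists_norm_fejerCompletion_sub_lt`). Since the multiplier has finite
support, only finitely many Gaussian factors have to be inverted: a bounded finite-rank `R`
satisfies `R ∘ Q_h = fejer 0 F` (`exists_comp_quant_eq_fejerCompletion`). Hence `Q_h a = 0` makes
all Fejér means of `a` vanish, and `a = 0`.

If `Q_h` were surjective, the open mapping theorem and injectivity would bound its inverse. But
`‖W^0(f)‖ = 1` while `‖Q_h W^0(f)‖ = exp (-(h/4) ‖f‖²)` tends to 0 along a ray in `E`. -/

open scoped ComplexOrder

noncomputable section

open Filter Topology

/-! ### Almost invariant finite sets in abelian groups -/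

/-- Finite sets of an additive commutative group that are almost invariant under given
translations. -/
theorem exists_almost_invariant_finset {G : Type*} [AddCommGroup G] [DecidableEq G]
    (S : Finset G) {ε : ℝ} (hε : 0 < ε) :
    ∃ F : Finset G, F.Nonempty ∧
      ∀ s ∈ S, (1 - ε) * F.card ≤ (F.filter fun k => k + s ∈ F).card := by
  -- Combinations of `S` with coefficients in `{0, …, N}`: at most `(N + 1) ^ |S|` elements, and
  -- translation by `s ∈ S` leads into the next box.
  let B : ℕ → Finset G := fun N =>
    (Fintype.piFinset fun _ : S => Finset.range (N + 1)).image fun n => ∑ s : S, n s • (s : G)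
  have hB0 : ∀ N, (B N).Nonempty := fun N =>
    Finset.Nonempty.image ⟨0, by simp⟩ _
  have hBcard : ∀ N, (B N).card ≤ (N + 1) ^ S.card := fun N =>
    Finset.card_image_le.trans (by simp)
  have hBsub : ∀ N, B N ⊆ B (N + 1) := fun N =>
    Finset.image_subset_image <| Fintype.piFinset_subset _ _ fun _ =>
      Finset.range_subset_range.mpr (by lia)
  have hBadd : ∀ N, ∀ s ∈ S, ∀ k ∈ B N, k + s ∈ B (N + 1) := by
    intro N s hs k hk
    obtain ⟨n, hn, rfl⟩ := Finset.mem_image.mp hk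
    refine Finset.mem_image.mpr ⟨n + Pi.single ⟨s, hs⟩ 1, ?_, ?_⟩
    · rw [Fintype.mem_piFinset] at hn ⊢
      intro t
      have ht := Finset.mem_range.mp (hn t)
      rw [Finset.mem_range, Pi.add_apply]
      by_cases h : t = ⟨s, hs⟩
      · subst h; simp; lia
      · rw [Pi.single_eq_of_ne h]; lia
    · simp only [Pi.add_apply, add_smul, Finset.sum_add_distrib]
      congr 1
      rw [Finset.sum_eq_single ⟨s, hs⟩]
      · simp
      · intro t _ ht
        simp [Pi.single_eq_of_ne ht]
      · simp
  -- Otherwise the boxes would grow exponentially, against the polynomial bound.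
  obtain ⟨N, hN⟩ : ∃ N, ((B (N + 1)).card : ℝ) ≤ (1 + ε) * (B N).card := by
    by_contra! hgrow
    have hexp : ∀ N, (1 + ε) ^ N ≤ ((B N).card : ℝ) := by
      intro N
      induction N with
      | zero => simpa using (hB0 0).card_pos
      | succ N ih =>
        rw [pow_succ']
        exact (mul_le_mul_of_nonneg_left ih (by positivity)).trans (hgrow N).le
    have hlim := tendsto_pow_const_div_const_pow_of_one_lt S.card
      (show (1 : ℝ) < 1 + ε by linarith)
    -- The shift matches the base `N + 1` of the cardinality bound; the surplus factor `1 + ε` in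
    -- the denominator is absorbed by the threshold `(1 + ε)⁻¹`.
    have hlim1 := (tendsto_add_atTop_iff_nat 1).mpr hlim
    have hc : (0 : ℝ) < (1 + ε)⁻¹ := by positivity
    obtain ⟨N, hN⟩ := (hlim1.eventually_lt_const hc).exists
    have h1 : ((N + 1 : ℕ) : ℝ) ^ S.card < (1 + ε) ^ N := by
      rw [div_lt_iff₀ (by positivity), pow_succ', inv_mul_cancel_left₀ (by positivity)] at hN
      exact hN
    have h2 : ((B N).card : ℝ) ≤ ((N + 1 : ℕ) : ℝ) ^ S.card := mod_cast hBcard N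
    linarith [hexp N]
  refine ⟨B N, hB0 N, fun s hs => ?_⟩
  -- Translation by `s` injects the points that leave `B N` into the layer `B (N + 1) \ B N`, which
  -- has at most `ε |B N|` points.
  have himg : ((B N).filter fun k => k + s ∉ B N).card ≤ (B (N + 1) \ B N).card := by
    refine Finset.card_le_card_of_injOn (· + s) ?_ (add_left_injective s).injOn
    intro k hk
    have hk := Finset.mem_filter.mp hk
    exact Finset.mem_coe.mpr (Finset.mem_sdiff.mpr ⟨hBadd N s hs k hk.1, hk.2⟩)
  have h1 := Finset.card_filter_add_card_filter_not (s := B N) (fun k => k + s ∈ B N)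
  have h2 := Finset.card_sdiff_add_card_eq_card (hBsub N)
  have h1' : (((B N).filter fun k => k + s ∈ B N).card : ℝ) +
    ((B N).filter fun k => k + s ∉ B N).card = (B N).card := mod_cast h1
  have h2' : ((B (N + 1) \ B N).card : ℝ) + (B N).card = (B (N + 1)).card := mod_cast h2
  have h3' : (((B N).filter fun k => k + s ∉ B N).card : ℝ) ≤ (B (N + 1) \ B N).card :=
    mod_cast himg
  linarith

namespace Weyl

/-! ### Finite sums in the seminorm of a state -/

namespace AlgState

variable {A : Type*} [Ring A] [StarRing A] [Algebra ℂ A] [StarModule ℂ A]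

theorem sqrt_sum_le (ω : AlgState A) {ι : Type*} (s : Finset ι) (a : ι → A) :
    Real.sqrt (ω.toLin (star (∑ i ∈ s, a i) * ∑ i ∈ s, a i)).re ≤
      ∑ i ∈ s, Real.sqrt (ω.toLin (star (a i) * a i)).re := by
  let G : SeminormedAddCommGroup A :=
    @InnerProductSpace.Core.toSeminormedAddCommGroup ℂ A _ _ _ ω.core
  exact @norm_sum_le ι A G s a

/-- Triangle inequality followed by Cauchy–Schwarz for the finite sum. When the sum is an average
over `s`, the factor `s.card` cancels one of the two normalising factors. -/
theorem re_sum_le (ω : AlgState A) {ι : Type*} (s : Finset ι) (a : ι → A) :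
    (ω.toLin (star (∑ i ∈ s, a i) * ∑ i ∈ s, a i)).re ≤
      s.card * ∑ i ∈ s, (ω.toLin (star (a i) * a i)).re := by
  calc (ω.toLin (star (∑ i ∈ s, a i) * ∑ i ∈ s, a i)).re
      ≤ (∑ i ∈ s, Real.sqrt (ω.toLin (star (a i) * a i)).re) ^ 2 :=
        (Real.sqrt_le_iff.mp (ω.sqrt_sum_le s a)).2
    _ ≤ s.card * ∑ i ∈ s, Real.sqrt (ω.toLin (star (a i) * a i)).re ^ 2 :=
        sq_sum_le_card_mul_sum_sq
    _ = _ := by simp only [Real.sq_sqrt (ω.re_nonneg _)]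

end AlgState

variable {H : Type*} [NormedAddCommGroup H] [InnerProductSpace ℂ H]

/-! ### Norms of Weyl elements and of coefficients -/

namespace Alg

variable {E : Submodule ℝ H} {h : NNReal}

theorem linearMap_ext {M : Type*} [AddCommMonoid M] [Module ℂ M] {u v : Alg E h →ₗ[ℂ] M}
    (huv : ∀ f, u (W E h f) = v (W E h f)) : u = v := by
  ext a
  induction a using induction with
  | zero => simp
  | add a b ha hb => simp [ha, hb]
  | smul_W z f => simp [huv]

theorem norm_W (f : E) : ‖W E h f‖ = 1 := by
  rw [norm_def]
  refine le_antisymm (maxNorm_le zero_le_one fun ω => ?_) ?_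
  · simp [star_W_mul_self, ω.map_one]
  · have := le_maxNorm_sq statesBounded (centralState E h) (W E h f)
    rw [star_W_mul_self, AlgState.map_one, Complex.one_re] at this
    exact (one_le_sq_iff₀ (maxNorm_nonneg _)).mp this

/-- The central state sends `a* a` to the sum of the squared moduli of all coefficients. Continuity
of the coefficients is what makes finite-rank maps bounded. -/
theorem norm_coeff_le (f : E) (a : Alg E h) : ‖coeff f a‖ ≤ ‖a‖ := by
  by_cases hf : f ∈ supp a
  · have h1 := le_maxNorm_sq statesBounded (centralState E h) a
    have h2 : star (coeff f a) * coeff f a ≤ coeff 0 (star a * a) := by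
      rw [coeff_zero_star_mul_self]
      exact Finset.single_le_sum (f := fun g => star (coeff g a) * coeff g a)
        (fun g _ => star_mul_self_nonneg _) hf
    have h3 := (Complex.le_def.mp h2).1
    rw [Complex.star_def, Complex.conj_mul'] at h3
    norm_cast at h3
    rw [norm_def]
    exact (abs_le_of_sq_le_sq' (h3.trans h1) (maxNorm_nonneg _)).2
  · rw [mem_supp, not_not] at hf
    rw [hf, norm_zero]
    exact norm_nonneg a

/-! ### Fejér-type multipliers -/

section Fejer

open scoped Classical

/-- The projection onto the span of the `W(f)` with `k + f ∈ F`. -/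
def window (h : NNReal) (F : Finset E) (k : E) : Alg E h →ₗ[ℂ] Alg E h :=
  lift fun f => (if k + f ∈ F then 1 else 0 : ℂ) • W E h f

/-- The proportion of `k ∈ F` with `k + f ∈ F`. -/
def overlap (F : Finset E) (f : E) : ℝ :=
  (F.card : ℝ)⁻¹ * (F.filter fun k => k + f ∈ F).card

/-- The Fejér-type map `W(f) ↦ overlap F f • W(f)`, the mean of the windows of `F`. -/
def fejer (h : NNReal) (F : Finset E) : Alg E h →ₗ[ℂ] Alg E h :=
  ((F.card : ℝ)⁻¹ : ℂ) • ∑ k ∈ F, window h F k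

theorem fejer_W (F : Finset E) (f : E) :
    fejer h F (W E h f) = (overlap F f : ℂ) • W E h f := by
  simp only [fejer, LinearMap.smul_apply, LinearMap.sum_apply, window, lift_W, ← Finset.sum_smul,
    smul_smul, overlap]
  congr 1
  push_cast
  rw [Finset.sum_boole]

theorem overlap_zero {F : Finset E} (hF : F.Nonempty) : overlap F 0 = 1 := by
  have : (F.card : ℝ) ≠ 0 := by exact_mod_cast hF.card_pos.ne'
  simp only [overlap, add_zero, Finset.filter_mem_eq_inter, Finset.inter_self]
  exact inv_mul_cancel₀ this

theorem overlap_le_one (F : Finset E) (f : E) : overlap F f ≤ 1 := by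
  rw [overlap, inv_mul_eq_div]
  refine div_le_one_of_le₀ ?_ (by positivity)
  exact_mod_cast Finset.card_filter_le F _

theorem overlap_eq_zero {F : Finset E} {f : E}
    (hf : f ∉ Finset.image₂ (· - ·) F F) : overlap F f = 0 := by
  rw [overlap, Finset.filter_eq_empty_iff.mpr]
  · simp
  · intro k hk hkf
    exact hf (Finset.mem_image₂.mpr ⟨k + f, hkf, k, hk, by abel⟩)

/-- Translating the counting variable by `f` turns the overlap into a Gram kernel of indicator
functions; this is its positive definiteness. The set `K` only has to contain every `k` that
contributes. -/
theorem overlap_sub {F : Finset E} {f g : E} {K : Finset E}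
    (hK : ∀ x ∈ F, x - f ∈ K) :
    (overlap F (g - f) : ℂ) = ((F.card : ℝ)⁻¹ : ℂ) * ∑ k ∈ K,
      (if k + f ∈ F then 1 else 0) * (if k + g ∈ F then 1 else 0) := by
  have e : (F.filter fun k => k + (g - f) ∈ F).card =
      (K.filter fun k => k + f ∈ F ∧ k + g ∈ F).card := by
    refine Finset.card_bij' (fun k _ => k - f) (fun k _ => k + f) ?_ ?_ ?_ ?_
    · intro k hk
      obtain ⟨h1, h2⟩ := Finset.mem_filter.mp hk
      refine Finset.mem_filter.mpr ⟨hK k h1, by simpa using h1, ?_⟩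
      have : k - f + g = k + (g - f) := by abel
      rwa [this]
    · intro k hk
      obtain ⟨h1, h2, h3⟩ := Finset.mem_filter.mp hk
      refine Finset.mem_filter.mpr ⟨h2, ?_⟩
      have : k + f + (g - f) = k + g := by abel
      rwa [this]
    · simp
    · simp
  have e2 : ∀ k, (if k + f ∈ F then 1 else 0) * (if k + g ∈ F then 1 else 0) =
      (if k + f ∈ F ∧ k + g ∈ F then 1 else 0 : ℂ) := by
    intro k
    split_ifs <;> simp_all
  simp only [e2]
  rw [Finset.sum_boole, ← e, overlap]
  push_cast
  congr

/-- `W(f)* W(g)` is a phase times `W(g - f)`, so the multiplier acts on it by `overlap F (g - f)`,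
whose Gram form splits the result into squares of windows. The phases play no role, hence any `h` is
allowed. -/
theorem fejer_star_mul_self (F : Finset E) (a : Alg E h) {K : Finset E}
    (hK : ∀ x ∈ F, ∀ f ∈ supp a, x - f ∈ K) :
    fejer h F (star a * a) =
      ((F.card : ℝ)⁻¹ : ℂ) • ∑ k ∈ K, star (window h F k a) * window h F k a := by
  have hw : ∀ k, window h F k a =
      ∑ f ∈ supp a, (coeff f a * (if k + f ∈ F then 1 else 0)) • W E h f := by
    intro k
    conv_lhs => rw [eq_sum a, map_sum]
    simp only [map_smul, window, lift_W, smul_smul]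
  have hs : ∀ f g : E, fejer h F (star (W E h f) * W E h g) =
      (overlap F (g - f) : ℂ) • (star (W E h f) * W E h g) := by
    intro f g
    rw [star_W_mul_W, map_smul, fejer_W, smul_comm]
  simp only [hw, star_sum_mul_sum]
  conv_lhs => rw [eq_sum a, star_sum_mul_sum, map_sum]
  rw [Finset.sum_comm, Finset.smul_sum]
  refine Finset.sum_congr rfl fun f hf => ?_
  rw [Finset.sum_comm, Finset.smul_sum, map_sum]
  refine Finset.sum_congr rfl fun g _ => ?_
  rw [map_smul, hs, ← Finset.sum_smul, smul_smul, smul_smul,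
    overlap_sub (K := K) fun x hx => hK x hx f hf]
  congr 1
  simp only [Finset.mul_sum]
  refine Finset.sum_congr rfl fun k _ => ?_
  rw [star_mul']
  split_ifs <;> simp
  ring

/-- A Schwarz inequality for the Fejér map: the square of the mean of the windows over `F` is at
most the mean of their squares, and the windows with `k ∉ F` only add positive terms. It yields
contractivity without norm bounds for single windows. -/
theorem fejer_schwarz (ω : AlgState (Alg E h)) {F : Finset E} (hF : F.Nonempty) (a : Alg E h) :
    0 ≤ ω.toLin (fejer h F (star a * a)) ∧
      (ω.toLin (star (fejer h F a) * fejer h F a)).re ≤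
        (ω.toLin (fejer h F (star a * a))).re := by
  have hc : (0 : ℝ) < F.card := by exact_mod_cast hF.card_pos
  -- The differences make the square formula valid; `F` is adjoined so that the sum also covers the
  -- windows averaged in `fejer`.
  have e := fejer_star_mul_self F a (K := F ∪ Finset.image₂ (· - ·) F (supp a))
    fun x hx f hf => Finset.mem_union_right _ (Finset.mem_image₂_of_mem hx hf)
  have hc' : (0 : ℂ) ≤ ((F.card : ℝ)⁻¹ : ℂ) := by
    rw [← Complex.ofReal_inv, Complex.zero_le_real]
    positivity
  rw [e, map_smul, map_sum, smul_eq_mul]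
  refine ⟨mul_nonneg hc' (Finset.sum_nonneg fun k _ => ω.nonneg _), ?_⟩
  rw [fejer, LinearMap.smul_apply, LinearMap.sum_apply, ω.re_smul, ← Complex.ofReal_inv,
    Complex.norm_real, Real.norm_of_nonneg (by positivity), Complex.re_ofReal_mul, Complex.re_sum]
  calc _ ≤ (F.card : ℝ)⁻¹ ^ 2 * (F.card * ∑ k ∈ F,
        (ω.toLin (star (window h F k a) * window h F k a)).re) :=
        mul_le_mul_of_nonneg_left (ω.re_sum_le F _) (by positivity)
    _ = (F.card : ℝ)⁻¹ * ∑ k ∈ F,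
        (ω.toLin (star (window h F k a) * window h F k a)).re := by
        field_simp
    _ ≤ _ := by
        refine mul_le_mul_of_nonneg_left ?_ (by positivity)
        exact Finset.sum_le_sum_of_subset_of_nonneg Finset.subset_union_left
          fun k _ _ => ω.re_nonneg _

/-- The pull-back of a state under a Fejér-type map. -/
def fejerState (ω : AlgState (Alg E h)) {F : Finset E} (hF : F.Nonempty) :
    AlgState (Alg E h) where
  toLin := ω.toLin ∘ₗ fejer h F
  nonneg a := (fejer_schwarz ω hF a).1
  map_one := by
    rw [LinearMap.comp_apply, one_def, fejer_W, overlap_zero hF, ← one_def, map_smul, ω.map_one]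
    simp

theorem norm_fejer_le {F : Finset E} (hF : F.Nonempty) (a : Alg E h) :
    ‖fejer h F a‖ ≤ 1 * ‖a‖ := by
  rw [one_mul, norm_def, norm_def]
  exact maxNorm_le (maxNorm_nonneg _) fun ω => (fejer_schwarz ω hF a).2.trans
    (le_maxNorm_sq statesBounded (fejerState ω hF) a)

/-- For `F` almost invariant under the support of `a`, every relevant overlap is near 1, and Weyl
elements have norm 1. -/
theorem exists_norm_fejer_sub_le (a : Alg E h) {ε : ℝ} (hε : 0 < ε) :
    ∃ F : Finset E, F.Nonempty ∧ ‖fejer h F a - a‖ ≤ ε := by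
  set C := ∑ f ∈ supp a, ‖coeff f a‖ with hC
  have hC0 : 0 ≤ C := Finset.sum_nonneg fun _ _ => norm_nonneg _
  -- The total error is at most `C` times this; the added 1 covers `C = 0`.
  have hδ : 0 < ε / (C + 1) := by positivity
  obtain ⟨F, hF, hFS⟩ := exists_almost_invariant_finset (supp a) hδ
  have hc : (0 : ℝ) < F.card := by exact_mod_cast hF.card_pos
  refine ⟨F, hF, ?_⟩
  have e : fejer h F a - a = ∑ f ∈ supp a, (coeff f a * (overlap F f - 1 : ℝ)) • W E h f := by
    conv_lhs => rw [eq_sum a, map_sum, ← Finset.sum_sub_distrib]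
    refine Finset.sum_congr rfl fun f _ => ?_
    rw [map_smul, fejer_W, ← smul_sub, mul_smul]
    push_cast
    rw [sub_smul, one_smul]
  rw [e]
  calc _ ≤ ∑ f ∈ supp a, ‖coeff f a‖ * (ε / (C + 1)) := by
        refine norm_sum_le_of_le _ fun f hf => ?_
        rw [norm_smul, norm_W, mul_one, norm_mul, Complex.norm_real]
        refine mul_le_mul_of_nonneg_left ?_ (norm_nonneg _)
        rw [Real.norm_eq_abs, abs_sub_comm, abs_of_nonneg (sub_nonneg.mpr (overlap_le_one F f))]
        have h1 : 1 - ε / (C + 1) ≤ overlap F f := by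
          rw [overlap, inv_mul_eq_div, le_div_iff₀ hc]
          convert hFS f hf
        linarith
    _ = C * (ε / (C + 1)) := by rw [← Finset.sum_mul]
    _ ≤ ε := by
        rw [mul_div_assoc', div_le_iff₀ (by positivity)]
        nlinarith

/-! ### Inverting the Gaussian factors on finitely many Weyl elements -/

/-- The finite-rank map `W^h(f) ↦ overlap F f * exp ((h/4) ‖f‖²) • W⁰(f)`. -/
def fejerDequant (E : Submodule ℝ H) (h : NNReal) (F : Finset E) : Alg E h →ₗ[ℂ] Alg E 0 :=
  ∑ f ∈ Finset.image₂ (· - ·) F F,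
    (coeff f).smulRight (((overlap F f * Real.exp ((h / 4 : ℝ) * ‖f‖ ^ 2) : ℝ) : ℂ) • W E 0 f)

/-- The growing exponentials enter at only finitely many points, so the bound is finite, though not
uniform in `F`. -/
theorem norm_fejerDequant_le (F : Finset E) :
    ∃ C : ℝ, ∀ a : Alg E h, ‖fejerDequant E h F a‖ ≤ C * ‖a‖ := by
  refine ⟨∑ f ∈ Finset.image₂ (· - ·) F F,
    ‖((overlap F f * Real.exp ((h / 4 : ℝ) * ‖f‖ ^ 2) : ℝ) : ℂ) • W E 0 f‖, fun a => ?_⟩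
  rw [fejerDequant, LinearMap.sum_apply, Finset.sum_mul]
  refine norm_sum_le_of_le _ fun f _ => ?_
  rw [LinearMap.smulRight_apply, norm_smul, mul_comm]
  exact mul_le_mul_of_nonneg_left (norm_coeff_le f a) (norm_nonneg _)

/-- The two Gaussians cancel on `F - F`; elsewhere both sides vanish. -/
theorem fejerDequant_comp_quantAlg (F : Finset E) :
    fejerDequant E h F ∘ₗ quantAlg E h = fejer 0 F := by
  refine linearMap_ext fun f => ?_
  rw [LinearMap.comp_apply, quantAlg_W, map_smul, fejer_W, fejerDequant, LinearMap.sum_apply]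
  simp only [LinearMap.smulRight_apply, coeff_W, ite_smul, one_smul, zero_smul]
  rw [Finset.sum_ite_eq']
  split_ifs with hf
  · rw [smul_smul, ← Complex.ofReal_mul]
    congr 2
    rw [mul_left_comm, ← Real.exp_add, neg_mul, neg_add_cancel, Real.exp_zero, mul_one]
  · rw [overlap_eq_zero hf]
    simp

end Fejer

end Alg

/-! ### Extension to the completions -/

variable {E : Submodule ℝ H} {h : NNReal}

theorem norm_weyl (E : Submodule ℝ H) (h : NNReal) (f : E) : ‖weyl E h f‖ = 1 := by
  rw [weyl, UniformSpace.Completion.norm_coe, Alg.norm_W]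

/-- The continuous extension of a Fejér-type map to the completion. -/
def fejerCompletion (h : NNReal) {F : Finset E} (hF : F.Nonempty) : CStar E h →L[ℂ] CStar E h :=
  ((Alg.fejer h F).mkContinuous 1 (Alg.norm_fejer_le hF)).completion

theorem fejerCompletion_coe {F : Finset E} (hF : F.Nonempty) (a : Alg E h) :
    fejerCompletion h hF (a : CStar E h) = (Alg.fejer h F a : Alg E h) := by
  rw [fejerCompletion, ContinuousLinearMap.completion_apply_coe, LinearMap.mkContinuous_apply]

theorem norm_fejerCompletion_le {F : Finset E} (hF : F.Nonempty) (x : CStar E h) :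
    ‖fejerCompletion h hF x‖ ≤ ‖x‖ := by
  induction x using UniformSpace.Completion.induction_on with
  | hp => exact isClosed_le (fejerCompletion h hF).continuous.norm continuous_norm
  | ih x =>
    rw [fejerCompletion_coe, UniformSpace.Completion.norm_coe, UniformSpace.Completion.norm_coe,
      ← one_mul ‖x‖]
    exact Alg.norm_fejer_le hF x

theorem quant_coe (a : Alg E 0) :
    quant E h (a : CStar E 0) = (quantAlg E h a : Alg E h) := by
  rw [quant, ContinuousLinearMap.completion_apply_coe, LinearMap.mkContinuous_apply]

/-- Both sides are continuous, so the algebraic identity passes to the completion by density. -/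
theorem exists_comp_quant_eq_fejerCompletion (h : NNReal) {F : Finset E} (hF : F.Nonempty) :
    ∃ R : CStar E h →L[ℂ] CStar E 0, ∀ x, R (quant E h x) = fejerCompletion 0 hF x := by
  obtain ⟨C, hC⟩ := Alg.norm_fejerDequant_le (h := h) F
  let R : CStar E h →L[ℂ] CStar E 0 :=
    ((Alg.fejerDequant E h F).mkContinuous C hC).completion
  have hR : ∀ a : Alg E h, R (a : CStar E h) = (Alg.fejerDequant E h F a : Alg E 0) := fun a => by
    rw [ContinuousLinearMap.completion_apply_coe, LinearMap.mkContinuous_apply]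
  refine ⟨R, fun x => ?_⟩
  induction x using UniformSpace.Completion.induction_on with
  | hp =>
    exact isClosed_eq (R.continuous.comp (quant E h).continuous)
      (fejerCompletion 0 hF).continuous
  | ih x =>
    rw [quant_coe, hR, fejerCompletion_coe, ← Alg.fejerDequant_comp_quantAlg (h := h),
      LinearMap.comp_apply]

/-- Approximate `a` by an algebraic element first and choose `F` afterwards; this works because the
contraction bound is independent of `F`. -/
theorem exists_norm_fejerCompletion_sub_lt (a : CStar E h) {ε : ℝ} (hε : 0 < ε) :
    ∃ (F : Finset E) (hF : F.Nonempty), ‖fejerCompletion h hF a - a‖ < ε := by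
  obtain ⟨b, hb⟩ := UniformSpace.Completion.denseRange_coe.exists_dist_lt a
    (show 0 < ε / 3 by positivity)
  obtain ⟨F, hF, hFb⟩ := Alg.exists_norm_fejer_sub_le b (show 0 < ε / 3 by positivity)
  refine ⟨F, hF, ?_⟩
  rw [dist_eq_norm] at hb
  have h2 : ‖fejerCompletion h hF b - b‖ ≤ ε / 3 := by
    rw [fejerCompletion_coe, ← UniformSpace.Completion.coe_sub, UniformSpace.Completion.norm_coe]
    exact hFb
  generalize (b : CStar E h) = c at hb h2
  have h3 := norm_fejerCompletion_le hF (a - c)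
  have e : fejerCompletion h hF a - a =
      fejerCompletion h hF (a - c) + (fejerCompletion h hF c - c) - (a - c) := by
    rw [map_sub]; abel
  rw [e]
  linarith [norm_sub_le (fejerCompletion h hF (a - c) + (fejerCompletion h hF c - c)) (a - c),
    norm_add_le (fejerCompletion h hF (a - c)) (fejerCompletion h hF c - c)]

/-! ### Injectivity and failure of surjectivity -/

theorem quant_injective (E : Submodule ℝ H) (h : NNReal) : Function.Injective (quant E h) := by
  rw [injective_iff_map_eq_zero]
  intro a ha
  refine norm_le_zero_iff.mp (le_of_forall_pos_le_add fun ε hε => ?_)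
  obtain ⟨F, hF, hFa⟩ := exists_norm_fejerCompletion_sub_lt a hε
  obtain ⟨R, hR⟩ := exists_comp_quant_eq_fejerCompletion h hF
  rw [← hR, ha, map_zero, zero_sub, norm_neg] at hFa
  rw [zero_add]
  exact hFa.le

theorem quant_not_surjective (hh : 0 < h) (hE : E ≠ ⊥) :
    ¬ Function.Surjective (quant E h) := by
  intro hsurj
  -- Open mapping theorem: preimages can be chosen with linearly controlled norm.
  obtain ⟨C, hC0, hC⟩ := (quant E h).exists_preimage_norm_le hsurj
  have hbound : ∀ f : E, 1 ≤ C * Real.exp (-(h / 4 : ℝ) * ‖f‖ ^ 2) := by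
    intro f
    obtain ⟨a, ha, hle⟩ := hC (quant E h (weyl E 0 f))
    -- By injectivity the controlled preimage is `W^0(f)` itself.
    rw [quant_injective E h ha, quant_weyl, norm_smul, norm_weyl, norm_weyl, mul_one,
      Complex.norm_real, Real.norm_of_nonneg (Real.exp_pos _).le] at hle
    exact hle
  obtain ⟨f, hfE, hf⟩ := E.ne_bot_iff.mp hE
  have hn : 0 < ‖f‖ := norm_pos_iff.mpr hf
  have hh' : (0 : ℝ) < h := hh
  -- Along the ray `t • f` in `E` the Gaussian factor decays to 0, contradicting the uniform lower
  -- bound.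
  have hlim : Tendsto (fun t : ℝ => C * Real.exp (-((h / 4 : ℝ) * ‖f‖ ^ 2 * t ^ 2))) atTop
      (𝓝 (C * 0)) := by
    refine Tendsto.const_mul C (Real.tendsto_exp_neg_atTop_nhds_zero.comp ?_)
    exact (tendsto_pow_atTop two_ne_zero).const_mul_atTop (by positivity)
  rw [mul_zero] at hlim
  obtain ⟨t, ht⟩ := (hlim.eventually_lt_const zero_lt_one).exists
  refine absurd (hbound (t • ⟨f, hfE⟩)) (not_le.mpr ?_)
  convert ht using 3
  rw [norm_smul, Submodule.coe_norm, mul_pow, Real.norm_eq_abs, sq_abs]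
  ring

end Weyl

end

theorem mainTheorem3 {H : Type*} [NormedAddCommGroup H] [InnerProductSpace ℂ H]
    (E : Submodule ℝ H) (h : NNReal) :
    Function.Injective (Weyl.quant E h) ∧
      (0 < h → E ≠ ⊥ → ¬ Function.Surjective (Weyl.quant E h)) :=
  ⟨Weyl.quant_injective E h, Weyl.quant_not_surjective⟩
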